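/- Let $I\subseteq\mathbb{R}$ be an open interval (or, more generally, an open set), and let $u_{-1}(\tau_2)$, $u_0(\tau_2)$ be arbitrary real- or complex-valued functions on $I$. Let $c_j(\tau_2)$, $j=0,1,2,\ldots$, be differentiable functions on $I$, with $c_0$ nowhere zero, satisfying $$\frac{dc_j}{d\tau_2} = (j+2)\,c_{j+2} + \frac{u_0}{c_0}\Big( 2(u_0+u_{-1})\sum_{i=0}^{j-1} c_i c_{j-i} + \sum_{i=1}^{j} c_i c_{j+1-i}\Big),\qquad j=0,1,2,\ldots,$$ where empty sums are zero. For $m=0,1$ and $n\ge 1$ let $H^m_n=\det(c_{i+j+m})_{i,j=0}^{n-1}$, let $H^m_0=1$, and assume that no $H^m_n$ vanishes anywhere on $I$. Define $$u_{2n-1}=\frac{H^0_{n-1}H^1_n}{H^0_nH^1_{n-1}},\qquad u_{2n}=\frac{H^0_{n+1}H^1_{n-1}}{H^0_nH^1_n},\qquad n=1,2,\ldots.$$ Then $(u_n)_{n\ge -1}$ solves the second non-autonomous Volterra lattice equation on the right half lattice: for all $n=1,2,\ldots$, the function $u_n$ is differentiable on $I$ and $$\frac{du_n}{d\tau_2}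 = u_n\Big( (3-n)u_{n-2}u_{n-1} + (3-n)u_{n-1}^2 + (2-n)u_{n-1}u_n + u_n^2 + (n+3)u_nu_{n+1} + (n+2)u_{n+1}^2 + (n+2)u_{n+1}u_{n+2} + 2(u_{n+1}-u_{n-1})\sum_{i=1}^{n-1}u_i\Big).$$ -/

import Mathlib

open Finset

/-- The Hankel determinant `H^m_n = det (c_{i+j+m})_{i,j=0}^{n-1}` of a sequence of scalars;
it equals `1` for `n = 0`. -/
def hankelDet {𝕜 : Type*} [RCLike 𝕜] (c : ℕ → 𝕜) (m n : ℕ) : 𝕜 :=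
  Matrix.det (Matrix.of fun i j : Fin n => c ((i : ℕ) + (j : ℕ) + m))

/-- `c_0, c_1, …` are differentiable on `I`, `c_0` vanishes nowhere on `I`, and on `I` they satisfy
`dc_j/dτ = (j+2) c_{j+2}
  + (u_0/c_0) (2 (u_0 + u_{-1}) ∑_{i=0}^{j-1} c_i c_{j-i} + ∑_{i=1}^{j} c_i c_{j+1-i})`,
where `v` and `w` stand for `u_{-1}` and `u_0`. -/
def IsRiccatiSolution {𝕜 : Type*} [RCLike 𝕜] (I : Set ℝ) (v w : ℝ → 𝕜) (c : ℕ → ℝ → 𝕜) : Prop :=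
  ∀ τ ∈ I, c 0 τ ≠ 0 ∧ ∀ j : ℕ,
    HasDerivAt (c j)
      (((j : 𝕜) + 2) * c (j + 2) τ
        + w τ / c 0 τ *
          (2 * (w τ + v τ) * ∑ i ∈ range j, c i τ * c (j - i) τ
            + ∑ i ∈ Icc 1 j, c i τ * c (j + 1 - i) τ)) τ

/-- The second non-autonomous Volterra lattice equation holds for `u` on `I`
at all sites `n = 1, 2, …` of the right half lattice (it also involves `u_{-1}` and `u_0`). -/
def SolvesSecondNonautonomousVolterra {𝕜 : Type*} [RCLike 𝕜] (I : Set ℝ) (u : ℤ → ℝ → 𝕜) : Prop :=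
  ∀ n : ℕ, 1 ≤ n → ∀ τ ∈ I,
    HasDerivAt (u n)
      (u n τ *
        ((3 - (n : 𝕜)) * u (n - 2) τ * u (n - 1) τ
          + (3 - (n : 𝕜)) * u (n - 1) τ ^ 2
          + (2 - (n : 𝕜)) * u (n - 1) τ * u n τ
          + u n τ ^ 2
          + ((n : 𝕜) + 3) * u n τ * u (n + 1) τ
          + ((n : 𝕜) + 2) * u (n + 1) τ ^ 2
          + ((n : 𝕜) + 2) * u (n + 1) τ * u (n + 2) τ
          + 2 * (u (n + 1) τ - u (n - 1) τ) * ∑ i ∈ Ico 1 n, u (i : ℤ) τ)) τ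

/-! Let f = ∑ c_j X^j, and expand it as a Stieltjes continued fraction by iterating g = g_0 / (1 - X
h), where h is the remainder of g. Two facts about this expansion give the theorem.

The constant terms of the successive remainders are the u_n. One step g ↦ h trades Hankel
determinants: H^1_n(g) = g_0^n H^0_n(h) and H^0_{n+1}(g) = g_0^{n+1} H^1_n(h) (`hankelDet_one_eq`,
`hankelDet_zero_succ_eq`). Hence regularity is inherited and the quotients defining u_n follow by
induction (`HankelRegular.constantCoeff_iterate`).

The moment equations say that f satisfies a Riccati equation in X and τ (`riccatiEq_of_moments`).
The substitution g = g_0 / (1 - X h) keeps the shape of that equation and changes only its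
parameters; comparing coefficients of X in the new equation yields the logarithmic τ-derivative of
g_0 (`RiccatiEq.remainder`). The parameters can be solved in closed form
(`exists_riccatiEq_iterate`), and the logarithmic derivative of u_n is then the bracket of the
lattice equation. -/

/-! ### Toeplitz factorization of Hankel matrices -/

section Hankel

variable {R : Type*} [CommRing R]

/-- If `c_{m+1} = ∑ c_a g_b` over `a + b = m`, then the bivariate convolution of `c`, `c` and the
Hankel kernel `g_{a+b}` is `c_0 c_{i+j+1}`. -/
theorem sum_antidiagonal_hankel_kernel {c g : ℕ → R}
    (h : ∀ m, c (m + 1) = ∑ p ∈ antidiagonal m, c p.1 * g p.2) (i j : ℕ) :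
    ∑ p ∈ antidiagonal i, ∑ q ∈ antidiagonal j, c p.1 * c q.1 * g (p.2 + q.2) =
      c 0 * c (i + j + 1) := by
  induction i generalizing j with
  | zero => simp [h, mul_sum, mul_assoc]
  | succ i ih =>
    rw [show i + 1 + j + 1 = i + (j + 1) + 1 by ring, ← ih (j + 1)]
    -- The double sum depends only on i + j: splitting off the boundary terms of the sums at (i,
    -- j+1) and (i+1, j) leaves c_{i+1} c_{j+1} plus the same sum with kernel g_{a+b+1}.
    have hr : ∑ p ∈ antidiagonal i, ∑ q ∈ antidiagonal (j + 1), c p.1 * c q.1 * g (p.2 + q.2) =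
        c (j + 1) * c (i + 1) + ∑ p ∈ antidiagonal i, ∑ q ∈ antidiagonal j,
          c p.1 * c q.1 * g (p.2 + q.2 + 1) := by
      simp only [Nat.sum_antidiagonal_succ' (n := j), sum_add_distrib, h i, mul_sum, add_zero,
        add_assoc, mul_assoc, mul_left_comm (c (j + 1))]
    rw [hr, Nat.sum_antidiagonal_succ', h j, mul_comm, ← h j]
    simp only [h j, mul_sum, zero_add, mul_assoc, add_assoc, add_comm 1]

/-- The lower triangular Toeplitz matrix of a sequence. -/
def lowerToeplitz (c : ℕ → R) (n : ℕ) : Matrix (Fin n) (Fin n) R :=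
  Matrix.of fun i j => if j ≤ i then c (i - j : ℕ) else 0

theorem det_lowerToeplitz (c : ℕ → R) (n : ℕ) : (lowerToeplitz c n).det = c 0 ^ n := by
  rw [Matrix.det_of_isLowerTriangular]
  · simp [lowerToeplitz]
  · intro i j hij
    have : ¬ j ≤ i := not_le.2 hij
    simp [lowerToeplitz, this]

theorem sum_lowerToeplitz_mul (c : ℕ → R) {n : ℕ} (i : Fin n) (F : ℕ → R) :
    ∑ a : Fin n, lowerToeplitz c n i a * F a = ∑ p ∈ antidiagonal (i : ℕ), c p.1 * F p.2 := by
  rw [← Nat.sum_antidiagonal_swap, Nat.sum_antidiagonal_eq_sum_range_succ_mk]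
  simp only [lowerToeplitz, Matrix.of_apply, Fin.le_def, Prod.swap]
  rw [Fin.sum_univ_eq_sum_range (fun a => (if a ≤ (i : ℕ) then c (i - a) else 0) * F a) n]
  symm
  refine sum_subset_zero_on_sdiff (range_subset_range.2 i.2) ?_ ?_
  · intro a ha
    have : ¬ a ≤ (i : ℕ) := by simp at ha; omega
    simp [this]
  · intro a ha
    have : a ≤ (i : ℕ) := by simp at ha; omega
    simp [this]

theorem lowerToeplitz_mul_mul_transpose_apply (c : ℕ → R) {n : ℕ} (K : ℕ → ℕ → R) (i j : Fin n) :
    (lowerToeplitz c n * Matrix.of (fun a b : Fin n => K a b) *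
      (lowerToeplitz c n).transpose) i j =
      ∑ p ∈ antidiagonal (i : ℕ), ∑ q ∈ antidiagonal (j : ℕ), c p.1 * c q.1 * K p.2 q.2 := by
  rw [Matrix.mul_assoc, Matrix.mul_apply]
  have : ∀ a : Fin n, (Matrix.of (fun a b : Fin n => K a b) * (lowerToeplitz c n).transpose) a j
      = ∑ q ∈ antidiagonal (j : ℕ), c q.1 * K a q.2 := by
    intro a
    rw [Matrix.mul_apply, ← sum_lowerToeplitz_mul]
    exact sum_congr rfl fun b _ => by simp [mul_comm]
  simp only [this]
  rw [sum_lowerToeplitz_mul c i fun a => ∑ q ∈ antidiagonal (j : ℕ), c q.1 * K a q.2]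
  simp only [mul_sum, mul_assoc]

/-- The hypothesis reads c_0 M = L K Lᵀ with L the lower triangular Toeplitz matrix of c, whose
determinant is c_0^n. Taking determinants gives c_0^n det M = c_0^{2n} det K. -/
theorem pow_mul_det_eq_of_convolution [IsDomain R] {c : ℕ → R} (h0 : c 0 ≠ 0) {n : ℕ}
    {M : Matrix (Fin n) (Fin n) R} (K : ℕ → ℕ → R)
    (h : ∀ i j : Fin n, ∑ p ∈ antidiagonal (i : ℕ), ∑ q ∈ antidiagonal (j : ℕ),
      c p.1 * c q.1 * K p.2 q.2 = c 0 * M i j) :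
    M.det = c 0 ^ n * (Matrix.of (fun a b : Fin n => K a b)).det := by
  have hM : c 0 • M = lowerToeplitz c n * Matrix.of (fun a b : Fin n => K a b) *
      (lowerToeplitz c n).transpose := by
    ext i j
    rw [lowerToeplitz_mul_mul_transpose_apply, h]
    rfl
  have hdet := congrArg Matrix.det hM
  rw [Matrix.det_smul, Matrix.det_mul, Matrix.det_mul, Matrix.det_transpose, det_lowerToeplitz,
    Fintype.card_fin] at hdet
  refine mul_left_cancel₀ (pow_ne_zero n h0) ?_
  rw [hdet]
  ring

end Hankel

/-! ### Hankel determinants under one continued fraction step -/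

section HankelDet

variable {𝕜 : Type*} [RCLike 𝕜] {c g : ℕ → 𝕜}

theorem hankelDet_zero (c : ℕ → 𝕜) (m : ℕ) : hankelDet c m 0 = 1 := by
  simp [hankelDet]

theorem hankelDet_one_eq (h0 : c 0 ≠ 0)
    (h : ∀ m, c (m + 1) = ∑ p ∈ antidiagonal m, c p.1 * g p.2) (n : ℕ) :
    hankelDet c 1 n = c 0 ^ n * hankelDet g 0 n :=
  pow_mul_det_eq_of_convolution h0 (fun a b => g (a + b)) fun i j =>
    sum_antidiagonal_hankel_kernel h i j

theorem hankelDet_zero_succ_eq (h0 : c 0 ≠ 0)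
    (h : ∀ m, c (m + 1) = ∑ p ∈ antidiagonal m, c p.1 * g p.2) (n : ℕ) :
    hankelDet c 0 (n + 1) = c 0 ^ (n + 1) * hankelDet g 1 n := by
  -- K is the block sum of 1 and (g_{a+b+1}). With c(x) = c_0 + x c(x) g(x), the identity behind it
  -- is c(x) c(y) (1 + x y (g(x) - g(y)) / (x - y)) = c_0 (x c(x) - y c(y)) / (x - y); the corner 1
  -- supplies the terms c_i c_j.
  let K : ℕ → ℕ → 𝕜 := fun a b =>
    match a, b with
    | 0, 0 => 1
    | 0, _ + 1 => 0
    | _ + 1, 0 => 0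
    | a + 1, b + 1 => g (a + b + 1)
  have key := pow_mul_det_eq_of_convolution h0 (n := n + 1)
    (M := Matrix.of fun i j : Fin (n + 1) => c ((i : ℕ) + (j : ℕ) + 0)) K ?_
  · rw [hankelDet, key, Matrix.det_succ_row_zero, Fin.sum_univ_succ]
    simp only [Matrix.of_apply, Fin.val_zero, Fin.val_succ, K]
    simp [hankelDet, Matrix.submatrix]
  · rintro ⟨i, hi⟩ ⟨j, hj⟩
    simp only [Matrix.of_apply, add_zero]
    rcases i with _ | i
    · simp only [Nat.antidiagonal_zero, sum_singleton]
      rcases j with _ | j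
      · simp [K]
      · rw [Nat.sum_antidiagonal_succ']
        simp [K]
    · rw [Nat.sum_antidiagonal_succ']
      rcases j with _ | j
      · simp [K, mul_comm]
      · simp only [Nat.sum_antidiagonal_succ' (n := j)]
        simp only [K, mul_zero, sum_const_zero, zero_add, mul_one, add_zero]
        rw [show i + 1 + (j + 1) = (i + 1) + j + 1 by ring, ← sum_antidiagonal_hankel_kernel h,
          Nat.sum_antidiagonal_succ']
        congr 1
        · simp [h j, mul_sum, mul_assoc]
        · simp [add_right_comm]

end HankelDet

/-! ### Riccati equations under one continued fraction step -/

section Riccati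

open PowerSeries

variable {K : Type*} [Field K]

/-- The remainder `h` of one step `g = g_0 + X g h` of the continued fraction expansion. -/
noncomputable def stieltjesRemainder (g : K⟦X⟧) : K⟦X⟧ :=
  PowerSeries.mk fun n => coeff (n + 1) (1 - C (constantCoeff g) * g⁻¹)

theorem eq_add_X_mul_stieltjesRemainder {g : K⟦X⟧} (h0 : constantCoeff g ≠ 0) :
    g = C (constantCoeff g) + X * g * stieltjesRemainder g := by
  have h : X * stieltjesRemainder g = 1 - C (constantCoeff g) * g⁻¹ := by
    ext n
    rcases n with _ | n
    · simp [h0]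
    · rw [coeff_succ_X_mul, stieltjesRemainder, coeff_mk]
  have hg : g * g⁻¹ = 1 := PowerSeries.mul_inv_cancel g h0
  linear_combination (-g) * h + C (constantCoeff g) * hg

theorem coeff_succ_eq_sum_antidiagonal {u : K} {g h : K⟦X⟧} (hg : g = C u + X * g * h) (m : ℕ) :
    coeff (m + 1) g = ∑ p ∈ antidiagonal m, coeff p.1 g * coeff p.2 h := by
  conv_lhs => rw [hg]
  rw [map_add, mul_assoc, coeff_succ_X_mul, coeff_mul, coeff_C]
  simp

/-- The Riccati equation
`X² D = X g' - k u - u s X + (k + q₁ X + q₂ X²) g + (ρ X - r X²) g²`. -/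
def RiccatiEq (k u s q₁ q₂ ρ r : K) (g D : K⟦X⟧) : Prop :=
  X ^ 2 * D = X * derivative K g - C (k * u) - X * C (u * s) +
    (C k + C q₁ * X + C q₂ * X ^ 2) * g + (C ρ * X - C r * X ^ 2) * g ^ 2

/-- The Riccati equation is inherited by the continued fraction remainder, and its solvability
determines the logarithmic derivative `v` of the leading coefficient. -/
theorem RiccatiEq.remainder {k u s q₁ q₂ ρ r v a b t : K} {g h D E : K⟦X⟧} (hu : u ≠ 0)
    (ha : coeff 0 h = a) (hb : coeff 1 h = a * b)
    (hg : g = C u + X * g * h) (hD : D = C (u * v) + X * (D * h + g * E))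
    (hs : s = q₁ + ρ * u + (k + 1) * a)
    (ht : t = (k + 2) * b + (2 * s - q₁) - k * a)
    (H : RiccatiEq k u s q₁ q₂ ρ r g D) :
    v = q₂ - r * u + a * t ∧
      RiccatiEq (k + 1) a t (2 * s - q₁) (v - q₂) (-k) s h E := by
  have hg' : derivative K g = g * h + X * (derivative K g * h + g * derivative K h) := by
    conv_lhs => rw [hg]
    simp only [map_add, Derivation.leibniz, derivative_C, derivative_X, smul_eq_mul]
    ring
  have key : X ^ 2 * E = X * derivative K h - C ((k + 1) * a) + X * C (q₂ - r * u - v) +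
      (C (k + 1) + C (2 * s - q₁) * X + C (v - q₂) * X ^ 2) * h +
      (C (-k) * X - C s * X ^ 2) * h ^ 2 := by
    -- Substituting g = u / (1 - X h) and multiplying by (1 - X h)^2 to clear denominators turns `H`
    -- into X u times the claim; `gy`, `Dy`, `zy` are the substitution rules for g and its two
    -- derivatives.
    have hXu : (X * C u : K⟦X⟧) ≠ 0 := mul_ne_zero X_ne_zero (by simpa using hu)
    refine mul_left_cancel₀ hXu ?_
    have hs' : C s = C q₁ + C ρ * C u + (C k + 1) * C a := by
      rw [hs]; simp only [map_add, map_mul, map_one]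
    have gy : g * (1 - X * h) = C u := by linear_combination hg
    have Dy : D * (1 - X * h) = C u * C v + X * g * E := by
      rw [map_mul] at hD; linear_combination hD
    have zy : derivative K g * (1 - X * h) = g * h + X * g * derivative K h := by
      linear_combination hg'
    unfold RiccatiEq at H
    simp only [map_add, map_mul, map_sub, map_neg, map_one, map_ofNat] at H ⊢
    linear_combination (1 - X * h) ^ 2 * H - X ^ 2 * (1 - X * h) * Dy - X ^ 3 * E * gy +
      X * (1 - X * h) * zy + (X * h + X ^ 2 * derivative K h) * gy +
      (C k + C q₁ * X + C q₂ * X ^ 2) * (1 - X * h) * gy +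
      (C ρ * X - C r * X ^ 2) * (g * (1 - X * h) + C u) * gy - X * C u * hs'
  -- The left side is divisible by X², so the coefficient of X on the right vanishes, which
  -- determines v. The formula for t is the analogue for h of the formula `hs` for s.
  have h1 := congrArg (coeff 1) key
  rw [show X ^ 2 * E = X * (X * E) by ring, show
    X * derivative K h - C ((k + 1) * a) + X * C (q₂ - r * u - v) +
      (C (k + 1) + C (2 * s - q₁) * X + C (v - q₂) * X ^ 2) * h +
      (C (-k) * X - C s * X ^ 2) * h ^ 2 =
    X * (derivative K h + C (q₂ - r * u - v) + C (2 * s - q₁) * h + C (-k) * h ^ 2 +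
      X * (C (v - q₂) * h - C s * h ^ 2)) - C ((k + 1) * a) + C (k + 1) * h by ring] at h1
  have ha' : constantCoeff h = a := by simpa using ha
  rw [coeff_succ_X_mul 0, map_add, map_sub, coeff_succ_X_mul 0, coeff_C_mul, hb, coeff_succ_C] at h1
  have hd : constantCoeff (derivative K h) = a * b := by
    rw [← coeff_zero_eq_constantCoeff_apply, coeff_derivative]
    simp [hb]
  simp [ha', hd] at h1
  have hv : v = q₂ - r * u + a * t := by
    rw [ht]; linear_combination h1
  refine ⟨hv, ?_⟩
  have hv' : q₂ - r * u - v = -(a * t) := by rw [hv]; ring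
  unfold RiccatiEq
  rw [key, hv', map_neg]
  ring

end Riccati

/-! ### Continued fraction coefficients and their evolution -/

section Evolution

open PowerSeries

variable {𝕜 : Type*} [RCLike 𝕜]

theorem hankelDet_one_eq_remainder {f : 𝕜⟦X⟧} (h0 : constantCoeff f ≠ 0) (n : ℕ) :
    hankelDet (fun j => coeff j f) 1 n =
      constantCoeff f ^ n * hankelDet (fun j => coeff j (stieltjesRemainder f)) 0 n := by
  rw [← coeff_zero_eq_constantCoeff_apply]
  exact hankelDet_one_eq (c := fun j => coeff j f) (by simpa using h0)
    (coeff_succ_eq_sum_antidiagonal (eq_add_X_mul_stieltjesRemainder h0)) n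

theorem hankelDet_zero_succ_eq_remainder {f : 𝕜⟦X⟧} (h0 : constantCoeff f ≠ 0) (n : ℕ) :
    hankelDet (fun j => coeff j f) 0 (n + 1) =
      constantCoeff f ^ (n + 1) * hankelDet (fun j => coeff j (stieltjesRemainder f)) 1 n := by
  rw [← coeff_zero_eq_constantCoeff_apply]
  exact hankelDet_zero_succ_eq (c := fun j => coeff j f) (by simpa using h0)
    (coeff_succ_eq_sum_antidiagonal (eq_add_X_mul_stieltjesRemainder h0)) n

/-- No Hankel determinant `H^0_n`, `H^1_n` of the coefficients vanishes. -/
def HankelRegular (f : 𝕜⟦X⟧) : Prop :=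
  ∀ n, hankelDet (fun j => coeff j f) 0 n ≠ 0 ∧ hankelDet (fun j => coeff j f) 1 n ≠ 0

theorem HankelRegular.constantCoeff_ne_zero {f : 𝕜⟦X⟧} (h : HankelRegular f) :
    constantCoeff f ≠ 0 := by
  simpa [hankelDet] using (h 1).1

theorem HankelRegular.remainder {f : 𝕜⟦X⟧} (h : HankelRegular f) :
    HankelRegular (stieltjesRemainder f) := by
  intro n
  have h0 := h.constantCoeff_ne_zero
  have h1 := (h n).2
  have h2 := (h (n + 1)).1
  rw [hankelDet_one_eq_remainder h0] at h1
  rw [hankelDet_zero_succ_eq_remainder h0] at h2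
  exact ⟨right_ne_zero_of_mul h1, right_ne_zero_of_mul h2⟩

theorem HankelRegular.iterate {f : 𝕜⟦X⟧} (h : HankelRegular f) (k : ℕ) :
    HankelRegular (stieltjesRemainder^[k] f) := by
  induction k with
  | zero => exact h
  | succ k ih => rw [Function.iterate_succ_apply']; exact ih.remainder

theorem coeff_one_eq_mul {f : 𝕜⟦X⟧} (h0 : constantCoeff f ≠ 0) :
    coeff 1 f = constantCoeff f * constantCoeff (stieltjesRemainder f) := by
  have := coeff_succ_eq_sum_antidiagonal (eq_add_X_mul_stieltjesRemainder h0) 0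
  simpa using this

/-- The continued fraction coefficients are quotients of Hankel determinants. -/
theorem HankelRegular.constantCoeff_iterate {f : 𝕜⟦X⟧} (h : HankelRegular f) (n : ℕ) :
    constantCoeff (stieltjesRemainder^[2 * n + 1] f) =
        (hankelDet (fun j => coeff j f) 0 n * hankelDet (fun j => coeff j f) 1 (n + 1)) /
          (hankelDet (fun j => coeff j f) 0 (n + 1) * hankelDet (fun j => coeff j f) 1 n) ∧
      constantCoeff (stieltjesRemainder^[2 * n + 2] f) =
        (hankelDet (fun j => coeff j f) 0 (n + 2) * hankelDet (fun j => coeff j f) 1 n) /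
          (hankelDet (fun j => coeff j f) 0 (n + 1) *
            hankelDet (fun j => coeff j f) 1 (n + 1)) := by
  -- A step swaps the roles of H^0 and H^1: the odd formula for the remainder gives the even one for
  -- f, and the even one gives the next odd one. The powers of the constant term cancel.
  have even_of_odd : ∀ n : ℕ, (∀ f : 𝕜⟦X⟧, HankelRegular f →
      constantCoeff (stieltjesRemainder^[2 * n + 1] f) =
        (hankelDet (fun j => coeff j f) 0 n * hankelDet (fun j => coeff j f) 1 (n + 1)) /
          (hankelDet (fun j => coeff j f) 0 (n + 1) * hankelDet (fun j => coeff j f) 1 n)) →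
      ∀ f : 𝕜⟦X⟧, HankelRegular f → constantCoeff (stieltjesRemainder^[2 * n + 2] f) =
        (hankelDet (fun j => coeff j f) 0 (n + 2) * hankelDet (fun j => coeff j f) 1 n) /
          (hankelDet (fun j => coeff j f) 0 (n + 1) *
            hankelDet (fun j => coeff j f) 1 (n + 1)) := by
    intro n H f h
    have h0 := h.constantCoeff_ne_zero
    have hr := h.remainder
    rw [Function.iterate_succ_apply, H _ hr]
    simp only [hankelDet_zero_succ_eq_remainder h0, hankelDet_one_eq_remainder h0]
    have h1 := (hr n).2
    have h2 := (hr (n + 1)).1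
    field_simp
    ring
  induction n generalizing f with
  | zero =>
    have odd : ∀ f : 𝕜⟦X⟧, HankelRegular f → constantCoeff (stieltjesRemainder^[2 * 0 + 1] f) =
        (hankelDet (fun j => coeff j f) 0 0 * hankelDet (fun j => coeff j f) 1 (0 + 1)) /
          (hankelDet (fun j => coeff j f) 0 (0 + 1) * hankelDet (fun j => coeff j f) 1 0) := by
      intro f h
      have h0 := h.constantCoeff_ne_zero
      simp only [hankelDet_zero_succ_eq_remainder h0, hankelDet_one_eq_remainder h0]
      simp [hankelDet_zero, h0]
      simp [hankelDet]
    exact ⟨odd f h, even_of_odd 0 odd f h⟩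
  | succ n ih =>
    have odd : ∀ f : 𝕜⟦X⟧, HankelRegular f →
        constantCoeff (stieltjesRemainder^[2 * (n + 1) + 1] f) =
        (hankelDet (fun j => coeff j f) 0 (n + 1) *
          hankelDet (fun j => coeff j f) 1 (n + 1 + 1)) /
          (hankelDet (fun j => coeff j f) 0 (n + 1 + 1) *
            hankelDet (fun j => coeff j f) 1 (n + 1)) := by
      intro f h
      have h0 := h.constantCoeff_ne_zero
      have hr := h.remainder
      rw [show 2 * (n + 1) + 1 = 2 * n + 2 + 1 by ring, Function.iterate_succ_apply, (ih hr).2]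
      simp only [hankelDet_zero_succ_eq_remainder h0, hankelDet_one_eq_remainder h0]
      have h1 := (hr (n + 1)).2
      have h2 := (hr (n + 1)).1
      field_simp
    exact ⟨odd f h, even_of_odd (n + 1) odd f h⟩

/-- Coefficientwise differentiability of a family of power series. -/
def HasCoeffDerivAt (F : ℝ → 𝕜⟦X⟧) (D : 𝕜⟦X⟧) (τ : ℝ) : Prop :=
  ∀ n, HasDerivAt (fun t => coeff n (F t)) (coeff n D) τ

/-- Near τ the constant term stays nonzero, so the convolution identity can be solved recursively
for the coefficients of the remainder, which are therefore differentiable. The equation for D is the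
product rule applied to g = g_0 + X g h. -/
theorem HasCoeffDerivAt.remainder {F : ℝ → 𝕜⟦X⟧} {D : 𝕜⟦X⟧} {τ : ℝ}
    (hF : HasCoeffDerivAt F D τ) (h0 : constantCoeff (F τ) ≠ 0) :
    ∃ E, HasCoeffDerivAt (fun t => stieltjesRemainder (F t)) E τ ∧
      D = C (constantCoeff D) + X * (D * stieltjesRemainder (F τ) + F τ * E) := by
  rw [← coeff_zero_eq_constantCoeff_apply] at h0
  have hne : ∀ᶠ t in nhds τ, coeff 0 (F t) ≠ 0 := (hF 0).continuousAt.eventually_ne h0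
  have hdiff : ∀ j, DifferentiableAt ℝ (fun t => coeff j (stieltjesRemainder (F t))) τ := by
    intro j
    induction j using Nat.strong_induction_on with
    | _ j ih =>
      have hEq : (fun t => coeff j (stieltjesRemainder (F t))) =ᶠ[nhds τ] fun t =>
          (coeff (j + 1) (F t) - ∑ i ∈ range j, coeff (i + 1) (F t) *
            coeff (j - (i + 1)) (stieltjesRemainder (F t))) / coeff 0 (F t) := by
        filter_upwards [hne] with t ht
        have := coeff_succ_eq_sum_antidiagonal (eq_add_X_mul_stieltjesRemainder
          (by simpa using ht)) j
        rw [Nat.sum_antidiagonal_eq_sum_range_succ_mk, sum_range_succ'] at this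
        rw [eq_div_iff ht, this]
        simp [mul_comm]
      refine DifferentiableAt.congr_of_eventuallyEq ?_ hEq
      refine ((hF _).differentiableAt.sub (DifferentiableAt.fun_sum fun i hi => ?_)).div
        (hF 0).differentiableAt h0
      have := mem_range.1 hi
      exact (hF _).differentiableAt.mul (ih _ (by omega))
  refine ⟨PowerSeries.mk fun j => deriv (fun t => coeff j (stieltjesRemainder (F t))) τ,
    fun j => by simpa using (hdiff j).hasDerivAt, ?_⟩
  ext n
  rcases n with _ | n
  · simp
  · rw [map_add, coeff_succ_X_mul, coeff_succ_C, zero_add, map_add, coeff_mul, coeff_mul,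
      ← sum_add_distrib]
    have hs : HasDerivAt (fun t => ∑ p ∈ antidiagonal n, coeff p.1 (F t) *
        coeff p.2 (stieltjesRemainder (F t))) _ τ :=
      HasDerivAt.fun_sum fun p _ => (hF p.1).mul (hdiff p.2).hasDerivAt
    have hEq : (fun t => coeff (n + 1) (F t)) =ᶠ[nhds τ] fun t => ∑ p ∈ antidiagonal n,
        coeff p.1 (F t) * coeff p.2 (stieltjesRemainder (F t)) := by
      filter_upwards [hne] with t ht
      exact coeff_succ_eq_sum_antidiagonal (eq_add_X_mul_stieltjesRemainder
          (by simpa using ht)) n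
    rw [(hF (n + 1)).unique (hs.congr_of_eventuallyEq hEq)]
    simp

/-- One step of the continued fraction expansion of a solution of a Riccati equation: the
logarithmic derivative `v` of the leading coefficient, and the equation for the remainder. -/
theorem RiccatiEq.exists_remainder {F : ℝ → 𝕜⟦X⟧} {D : 𝕜⟦X⟧} {τ : ℝ}
    {k u s q₁ q₂ ρ r a b t v : 𝕜} (hF : HasCoeffDerivAt F D τ) (hreg : HankelRegular (F τ))
    (hu : constantCoeff (F τ) = u) (ha : constantCoeff (stieltjesRemainder (F τ)) = a)
    (hb : constantCoeff (stieltjesRemainder (stieltjesRemainder (F τ))) = b)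
    (hs : s = q₁ + ρ * u + (k + 1) * a)
    (ht : t = (k + 2) * b + (2 * s - q₁) - k * a)
    (hv : v = q₂ - r * u + a * t)
    (H : RiccatiEq k u s q₁ q₂ ρ r (F τ) D) :
    HasDerivAt (fun x => constantCoeff (F x)) (u * v) τ ∧
      ∃ E, HasCoeffDerivAt (fun x => stieltjesRemainder (F x)) E τ ∧
        RiccatiEq (k + 1) a t (2 * s - q₁) (v - q₂) (-k) s (stieltjesRemainder (F τ)) E := by
  have hu0 := hreg.constantCoeff_ne_zero
  obtain ⟨E, hE, hD⟩ := hF.remainder hu0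
  have hg := eq_add_X_mul_stieltjesRemainder hu0
  rw [hu] at hg hu0
  -- The logarithmic derivative enters as an unknown; the Riccati equation then identifies it with
  -- v.
  have hDu : constantCoeff D = u * (constantCoeff D / u) := by field_simp
  rw [hDu] at hD
  obtain ⟨h1, h2⟩ := H.remainder (b := b) hu0 (by simpa using ha)
    (by rw [coeff_one_eq_mul hreg.remainder.constantCoeff_ne_zero, ha, hb]) hg hD hs ht
  rw [← hv] at h1
  rw [h1] at h2 hDu
  refine ⟨?_, E, hE, h2⟩
  have := hF 0
  rw [coeff_zero_eq_constantCoeff_apply, hDu] at this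
  simpa using this

/-- The Riccati equation of the generating function of a solution of the moment equations. -/
theorem riccatiEq_of_moments {c : ℕ → 𝕜} {d : ℕ → 𝕜} {v w a : 𝕜} (h0 : c 0 ≠ 0)
    (h1 : c 1 = c 0 * a)
    (hd : ∀ j, d j = ((j : 𝕜) + 2) * c (j + 2) + w / c 0 *
      (2 * (w + v) * ∑ i ∈ range j, c i * c (j - i) + ∑ i ∈ Icc 1 j, c i * c (j + 1 - i))) :
    RiccatiEq 0 (c 0) (a - w) (-2 * w) (-2 * w * (w + v)) (w / c 0)
      (-2 * (w / c 0) * (w + v)) (PowerSeries.mk c) (PowerSeries.mk d) := by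
  set f : 𝕜⟦X⟧ := PowerSeries.mk c with hf
  set f₁ : 𝕜⟦X⟧ := PowerSeries.mk fun n => c (n + 1) with hf₁
  have e : f = C (c 0) + X * f₁ := by
    ext n
    rcases n with _ | n
    · simp [f]
    · simp [f, f₁, coeff_succ_X_mul, coeff_succ_C]
  -- The sums over i are convolutions of f with f₁ and of f₁ with itself. Replacing X f₁ by f - c_0
  -- afterwards leaves an equation in f alone.
  have key : X * PowerSeries.mk d = derivative 𝕜 f - C (c 0 * a) +
      C (w / c 0) * (C (2 * (w + v)) * (X ^ 2 * (f * f₁)) + X ^ 2 * f₁ ^ 2) := by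
    ext n
    rcases n with _ | n
    · have : constantCoeff (derivative 𝕜 f) = c 1 := by
        rw [← coeff_zero_eq_constantCoeff_apply, coeff_derivative]
        simp [f]
      simp [this, h1]
    · have e1 : coeff n (X * (f * f₁)) = ∑ i ∈ range n, c i * c (n - i) := by
        rcases n with _ | n
        · simp
        · rw [coeff_succ_X_mul, coeff_mul, Nat.sum_antidiagonal_eq_sum_range_succ_mk]
          refine sum_congr rfl fun i hi => ?_
          have := mem_range.1 hi
          simp [f, f₁, show n + 1 - i = n - i + 1 by omega]
      have e2 : coeff n (X * f₁ ^ 2) = ∑ i ∈ Icc 1 n, c i * c (n + 1 - i) := by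
        rcases n with _ | n
        · simp
        · rw [coeff_succ_X_mul, sq, coeff_mul, Nat.sum_antidiagonal_eq_sum_range_succ_mk,
            ← Finset.Ico_add_one_right_eq_Icc, sum_Ico_eq_sum_range]
          refine sum_congr (by simp) fun i hi => ?_
          have := mem_range.1 hi
          simp [f₁, add_comm 1 i, show n + 1 + 1 - (i + 1) = n - i + 1 by omega]
      rw [show derivative 𝕜 f - C (c 0 * a) +
        C (w / c 0) * (C (2 * (w + v)) * (X ^ 2 * (f * f₁)) + X ^ 2 * f₁ ^ 2) =
        derivative 𝕜 f - C (c 0 * a) +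
        X * (C (w / c 0) * (C (2 * (w + v)) * (X * (f * f₁)) + X * f₁ ^ 2)) by ring]
      rw [map_add, map_sub, coeff_succ_X_mul, coeff_succ_X_mul, coeff_succ_C, coeff_C_mul, map_add,
        coeff_C_mul, e1, e2, coeff_derivative, coeff_mk, hd, coeff_mk]
      push_cast
      ring
  have hw : C (w / c 0) * C (c 0) = (C w : 𝕜⟦X⟧) := by
    rw [← map_mul, div_mul_cancel₀ _ h0]
  unfold RiccatiEq
  simp only [map_add, map_mul, map_sub, map_neg, map_zero, map_ofNat, zero_mul] at key ⊢
  linear_combination X * key - (C (w / c 0) * X * (f - C (c 0) + X * f₁) +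
    2 * C (w / c 0) * (C w + C v) * X ^ 2 * f) * e +
    (X * C (c 0) - 2 * X * f - 2 * (C w + C v) * X ^ 2 * f) * hw

end Evolution

/-! ### Closed form of the Riccati parameters and the lattice equation -/

section Volterra

open PowerSeries

variable {𝕜 : Type*} [RCLike 𝕜]

/-- The generating function of the moments at time `t`. -/
noncomputable def momentSeries (c : ℕ → ℝ → 𝕜) (t : ℝ) : 𝕜⟦X⟧ := PowerSeries.mk fun j => c j t

theorem hankelRegular_momentSeries {c : ℕ → ℝ → 𝕜} {t : ℝ}
    (h : ∀ n : ℕ, hankelDet (fun j => c j t) 0 n ≠ 0 ∧ hankelDet (fun j => c j t) 1 n ≠ 0) :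
    HankelRegular (momentSeries c t) := by
  simpa [HankelRegular, momentSeries] using h

/-- The data of the Riccati equation satisfied by the `n`-th continued fraction remainder, whose
leading coefficients are `u_n`. -/
theorem exists_riccatiEq_iterate {I : Set ℝ} {u : ℤ → ℝ → 𝕜} {c : ℕ → ℝ → 𝕜}
    (hc : IsRiccatiSolution I (u (-1)) (u 0) c)
    (hreg : ∀ τ ∈ I, HankelRegular (momentSeries c τ))
    (hu : ∀ n : ℕ, ∀ τ ∈ I,
      constantCoeff (stieltjesRemainder^[n + 1] (momentSeries c τ)) = u (n + 1 : ℕ) τ)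
    {τ : ℝ} (hτ : τ ∈ I) (m : ℕ) (S : 𝕜) (hS : S = ∑ i ∈ Ico 1 (m + 1), u (i : ℤ) τ) :
    ∃ E, HasCoeffDerivAt (fun t => stieltjesRemainder^[m + 1] (momentSeries c t)) E τ ∧
      RiccatiEq ((m : 𝕜) + 1) (u ((m : ℤ) + 1) τ)
        (2 * S + ((m : 𝕜) + 2) * (u ((m : ℤ) + 1) τ + u ((m : ℤ) + 2) τ))
        (2 * S + 2 * ((m : 𝕜) + 1) * u ((m : ℤ) + 1) τ)
        (u ((m : ℤ) + 1) τ *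
            (2 * S + ((m : 𝕜) + 2) * (u ((m : ℤ) + 1) τ + u ((m : ℤ) + 2) τ)) -
          u (m : ℤ) τ * (2 * S - 2 * u (m : ℤ) τ - 2 * u ((m : ℤ) - 1) τ +
            (m : 𝕜) * (u ((m : ℤ) - 1) τ + u (m : ℤ) τ)))
        (-(m : 𝕜))
        (2 * S - 2 * u (m : ℤ) τ + ((m : 𝕜) + 1) * (u (m : ℤ) τ + u ((m : ℤ) + 1) τ))
        (stieltjesRemainder^[m + 1] (momentSeries c τ)) E := by
  -- The induction starts at the first remainder, since f has leading coefficient c_0 instead of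
  -- u_0. Writing the earlier partial sums as S - u_m and S - u_m - u_{m-1} lets the formulas cover
  -- m = 0, where u_0 and u_{-1} enter although S is empty.
  induction m generalizing S with
  | zero =>
    have h0 := (hc τ hτ).1
    have hu0 := hu 0 τ hτ
    have hu1 := hu 1 τ hτ
    simp only [zero_add, Function.iterate_one, Nat.cast_one] at hu0
    simp only [Function.iterate_succ_apply', Function.iterate_zero, id, Nat.reduceAdd,
      Nat.cast_ofNat] at hu1
    have hcc : constantCoeff (momentSeries c τ) = c 0 τ := by simp [momentSeries]
    have h1 : c 1 τ = c 0 τ * u 1 τ := by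
      rw [← hcc, ← hu0, ← coeff_one_eq_mul (hcc ▸ h0)]
      simp [momentSeries]
    have H := riccatiEq_of_moments (c := fun j => c j τ) (v := u (-1) τ) (w := u 0 τ) h0 h1
      (fun j => rfl)
    obtain ⟨-, E, hE, hR⟩ := RiccatiEq.exists_remainder (F := momentSeries c)
      (fun j => by simpa [momentSeries] using (hc τ hτ).2 j) (hreg τ hτ) hcc hu0 hu1
      (by field_simp; ring) rfl rfl H
    refine ⟨E, hE, ?_⟩
    simp only [zero_add, Ico_self, sum_empty] at hS
    subst hS
    convert hR using 1 <;> simp <;> field_simp <;> ring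
  | succ m ih =>
    obtain ⟨D, hD, H⟩ := ih _ rfl
    set S₀ := ∑ i ∈ Ico 1 (m + 1), u (i : ℤ) τ with hS₀
    have hu0 := hu m τ hτ
    have hu1 := hu (m + 1) τ hτ
    have hu2 := hu (m + 2) τ hτ
    rw [Function.iterate_succ_apply'] at hu1
    rw [Function.iterate_succ_apply', Function.iterate_succ_apply'] at hu2
    obtain ⟨-, E, hE, hR⟩ := RiccatiEq.exists_remainder hD ((hreg τ hτ).iterate (m + 1))
      (by simpa using hu0) hu1 hu2 (by push_cast [add_assoc]; norm_num; ring) rfl rfl H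
    refine ⟨E, by simpa only [Function.iterate_succ_apply'] using hE, ?_⟩
    rw [sum_Ico_succ_top (by omega), ← hS₀] at hS
    subst hS
    rw [Function.iterate_succ_apply']
    push_cast [add_assoc] at hR ⊢
    norm_num at hR ⊢
    convert hR using 1 <;> ring

theorem solvesSecondNonautonomousVolterra_of_iterate {I : Set ℝ} (hI : IsOpen I)
    {u : ℤ → ℝ → 𝕜} {c : ℕ → ℝ → 𝕜}
    (hc : IsRiccatiSolution I (u (-1)) (u 0) c)
    (hreg : ∀ τ ∈ I, HankelRegular (momentSeries c τ))
    (hu : ∀ n : ℕ, ∀ τ ∈ I,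
      constantCoeff (stieltjesRemainder^[n + 1] (momentSeries c τ)) = u (n + 1 : ℕ) τ) :
    SolvesSecondNonautonomousVolterra I u := by
  intro n hn τ hτ
  obtain ⟨m, rfl⟩ : ∃ m, n = m + 1 := ⟨n - 1, by omega⟩
  obtain ⟨D, hD, H⟩ := exists_riccatiEq_iterate hc hreg hu hτ m _ rfl
  have hu0 := hu m τ hτ
  have hu1 := hu (m + 1) τ hτ
  have hu2 := hu (m + 2) τ hτ
  rw [Function.iterate_succ_apply'] at hu1
  rw [Function.iterate_succ_apply', Function.iterate_succ_apply'] at hu2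
  obtain ⟨hder, -⟩ := RiccatiEq.exists_remainder hD ((hreg τ hτ).iterate (m + 1))
    (by simpa using hu0) hu1 hu2 (by push_cast [add_assoc]; norm_num; ring) rfl rfl H
  -- Openness of I matters here: the determinant formula is known only on I, while the derivative
  -- needs it on a neighbourhood of τ.
  have hEq : u (m + 1 : ℕ) =ᶠ[nhds τ] fun t =>
      constantCoeff (stieltjesRemainder^[m + 1] (momentSeries c t)) := by
    filter_upwards [hI.mem_nhds hτ] with t ht using (hu m t ht).symm
  refine (hder.congr_of_eventuallyEq hEq).congr_deriv ?_
  rw [show ((m + 1 : ℕ) : ℤ) - 2 = m - 1 by push_cast; ring,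
    show ((m + 1 : ℕ) : ℤ) - 1 = m by push_cast; ring]
  push_cast [add_assoc]
  norm_num1
  ring

end Volterra

theorem theorem4 {𝕜 : Type*} [RCLike 𝕜] (I : Set ℝ) (hI : IsOpen I)
    (u : ℤ → ℝ → 𝕜) (c : ℕ → ℝ → 𝕜)
    (hc : IsRiccatiSolution I (u (-1)) (u 0) c)
    (hH : ∀ τ ∈ I, ∀ n : ℕ,
      hankelDet (fun j => c j τ) 0 n ≠ 0 ∧ hankelDet (fun j => c j τ) 1 n ≠ 0)
    (hodd : ∀ n : ℕ, 1 ≤ n → ∀ τ ∈ I,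
      u (2 * n - 1) τ =
        (hankelDet (fun j => c j τ) 0 (n - 1) * hankelDet (fun j => c j τ) 1 n) /
          (hankelDet (fun j => c j τ) 0 n * hankelDet (fun j => c j τ) 1 (n - 1)))
    (heven : ∀ n : ℕ, 1 ≤ n → ∀ τ ∈ I,
      u (2 * n) τ =
        (hankelDet (fun j => c j τ) 0 (n + 1) * hankelDet (fun j => c j τ) 1 (n - 1)) /
          (hankelDet (fun j => c j τ) 0 n * hankelDet (fun j => c j τ) 1 n)) :
    SolvesSecondNonautonomousVolterra I u := by
  have hreg : ∀ τ ∈ I, HankelRegular (momentSeries c τ) := fun τ hτ =>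
    hankelRegular_momentSeries (hH τ hτ)
  refine solvesSecondNonautonomousVolterra_of_iterate hI hc hreg fun n τ hτ => ?_
  rcases Nat.even_or_odd' n with ⟨k, rfl | rfl⟩
  · have h1 := ((hreg τ hτ).constantCoeff_iterate k).1
    have h2 := hodd (k + 1) (by omega) τ hτ
    rw [h1, show ((2 * k + 1 : ℕ) : ℤ) = 2 * (k + 1 : ℕ) - 1 by push_cast; ring, h2]
    simp [momentSeries]
  · have h1 := ((hreg τ hτ).constantCoeff_iterate k).2
    have h2 := heven (k + 1) (by omega) τ hτ
    rw [h1, show ((2 * k + 1 + 1 : ℕ) : ℤ) = 2 * (k + 1 : ℕ) by push_cast; ring, h2]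
    simp [momentSeries]
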